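/- Let $n, d$ be positive integers, let $\mu_1,\dots,\mu_n$ be Borel probability measures on $\mathbb{R}^d$ that are absolutely continuous with respect to Lebesgue measure, and let $x_1,\dots,x_n$ be $n$ distinct points (sites) in $\mathbb{R}^d$. For weights $\lambda_1,\dots,\lambda_n\in\mathbb{R}$, the power diagram with sites $x_i$ and weights $\lambda_i$ consists of the sets \[ C_j=\{y\in\mathbb{R}^d : \|y-x_j\|^2-\lambda_j\le \|y-x_i\|^2-\lambda_i \text{ for all } i\in\{1,\dots,n\}\},\qquad j=1,\dots,n. \] Then there exist real weights $\lambda_1,\dots,\lambda_n$ such that $(C_1,\dots,C_n)$ is an envy-free partition of $\mathbb{R}^d$ for $\mu_1,\dots,\mu_n$: the $C_j$ are closed convex (possibly empty) sets with union $\mathbb{R}^d$ and pairwise disjoint interiors, and there is a permutation $\pi$ of $\{1,\dots,n\}$ with \[ \mu_i(C_{\pi(i)})\ge\mu_i(C_{\pi(i')})\qquad\text{for all } i,i'\in\{1,\dots,n\}. \] -/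

import Mathlib

open MeasureTheory

/-- The `j`-th cell of the power diagram (generalized Voronoi diagram) with sites `x` and
weights `w`: all points whose power distance `dist² - weight` to the `j`-th site is minimal. -/
def powerDiagram {d n : ℕ} (x : Fin n → EuclideanSpace ℝ (Fin d)) (w : Fin n → ℝ)
    (j : Fin n) : Set (EuclideanSpace ℝ (Fin d)) :=
  {y | ∀ i : Fin n, dist y (x j) ^ 2 - w j ≤ dist y (x i) ^ 2 - w i}

/-- A convex partition of `ℝ^d` into `n` (possibly empty) closed convex parts: the parts cover
the space and have pairwise disjoint interiors. -/
structure IsConvexPartition {d n : ℕ} (C : Fin n → Set (EuclideanSpace ℝ (Fin d))) : Prop where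
  isClosed : ∀ i, IsClosed (C i)
  convex : ∀ i, Convex ℝ (C i)
  iUnion_eq : ⋃ i, C i = Set.univ
  disjoint_interior : ∀ i j, i ≠ j → Disjoint (interior (C i)) (interior (C j))

/-- `C` is an envy-free (convex) partition for the measures `μ`: the parts can be assigned
bijectively to the measures so that every measure receives a part which it values the most. -/
def IsEnvyFreePartition {d n : ℕ} (μ : Fin n → Measure (EuclideanSpace ℝ (Fin d)))
    (C : Fin n → Set (EuclideanSpace ℝ (Fin d))) : Prop :=
  IsConvexPartition C ∧
    ∃ π : Equiv.Perm (Fin n), ∀ i i' : Fin n, μ i (C (π i')) ≤ μ i (C (π i))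

/-! For weights `w`, let `A i j` be the set of `w` at which cell `j` is a favourite of `μ i`. For
each `i` these sets cover weight space. They are closed, since cell measures depend continuously on
`w` (ties lie in null hyperplanes). A favourite has measure at least `1/n`, whereas a cell whose
weight is far below another has measure less than that, so `A i j` contains only points where `w j`
is nearly maximal. It remains to find a point lying in `A i (π i)` for all `i`, a KKM–Gale
statement.

Each cover is mollified into a smooth partition of unity `p i`. The average of the `p i` equals the
uniform distribution at some `w`, because a related vector field points outwards at infinity and so
has a zero (`exists_forall_eq_inv`). There `p i w j` is a doubly stochastic matrix, and Birkhoff's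
theorem supplies a permutation with positive entries. Compactness removes the mollification. The
zero rests on the no-retraction theorem, proved by change of variables. -/

/-! ### No retraction, and zeros of outward vector fields -/

theorem bijective_add_of_lipschitzWith {E : Type*} [NormedAddCommGroup E] [CompleteSpace E]
    {h : E → E} {c : NNReal} (hc : c < 1) (hh : LipschitzWith c h) :
    Function.Bijective (fun x => x + h x) := by
  constructor
  · intro x y hxy
    have h1 : x - y = h y - h x := by
      have : x + h x = y + h y := hxy
      rw [sub_eq_sub_iff_add_eq_add, this, add_comm]
    have h2 := hh.dist_le_mul y x
    rw [dist_eq_norm, dist_eq_norm, ← h1, norm_sub_rev y x] at h2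
    have hc' : (c : ℝ) < 1 := by exact_mod_cast hc
    have h3 : ‖x - y‖ ≤ 0 := by nlinarith [norm_nonneg (x - y)]
    exact sub_eq_zero.1 (norm_le_zero_iff.1 h3)
  · intro y
    have hl : ContractingWith c (fun x => y - h x) := by
      refine ⟨hc, LipschitzWith.of_dist_le_mul fun a b => ?_⟩
      rw [dist_sub_left]
      exact hh.dist_le_mul a b
    obtain ⟨x, hx, -⟩ := hl.exists_fixedPoint y (edist_ne_top _ _)
    refine ⟨x, ?_⟩
    have : y - h x = x := hx
    exact (sub_eq_iff_eq_add.1 this).symm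

section
variable {E : Type*} [NormedAddCommGroup E] [NormedSpace ℝ E] [FiniteDimensional ℝ E]

theorem exists_det_one_add_eq_sum {ε : ℝ} (hε : 0 < ε) :
    ∃ (s : Finset ℝ) (c : ℝ → ℝ), (∀ t ∈ s, 0 < t ∧ t < ε) ∧
      ∀ A : E →L[ℝ] E, (1 + A).det = ∑ t ∈ s, c t * (1 + t • A).det := by
  classical
  let b := Module.finBasis ℝ E
  obtain ⟨s, hs, hcard⟩ := (Set.Ioo_infinite hε).exists_subset_card_eq (Module.finrank ℝ E + 1)
  refine ⟨s, fun t => (Lagrange.basis s id t).eval 1, fun t ht => hs ht, fun A => ?_⟩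
  let M := LinearMap.toMatrix b b (A : E →ₗ[ℝ] E)
  -- `det (1 + tA)` is a polynomial in `t` of degree at most `finrank`, so the `finrank + 1` nodes
  -- in `s` recover its value at `t = 1`.
  let P : Polynomial ℝ := Matrix.det ((Polynomial.X : Polynomial ℝ) • M.map Polynomial.C +
    (1 : Matrix _ _ ℝ).map Polynomial.C)
  have hP : ∀ t : ℝ, P.eval t = (1 + t • A).det := by
    intro t
    rw [ContinuousLinearMap.det, ← LinearMap.det_toMatrix b]
    simp only [P]
    rw [← Polynomial.coe_evalRingHom, RingHom.map_det]
    congr 1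
    ext i j
    have h1 : LinearMap.toMatrix b b ((1 + t • A : E →L[ℝ] E) : E →ₗ[ℝ] E) = 1 + t • M := by
      simp only [M, ContinuousLinearMap.toLinearMap_add, ContinuousLinearMap.toLinearMap_smul,
        map_add, map_smul]
      congr 1
      exact LinearMap.toMatrix_one b
    rw [h1]
    simp [Matrix.map_apply, add_comm, Matrix.one_apply, apply_ite]
    ring
  have hdeg : P.degree < s.card := by
    refine lt_of_le_of_lt Polynomial.degree_le_natDegree ?_
    have := Polynomial.natDegree_det_X_add_C_le M 1
    rw [Fintype.card_fin] at this
    rw [hcard]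
    exact_mod_cast Nat.lt_succ_of_le this
  have h := congrArg (Polynomial.eval 1) (Lagrange.eq_interpolate (v := id) Function.injective_id.injOn hdeg)
  rw [hP, one_smul, Lagrange.interpolate_apply, Polynomial.eval_finsetSum] at h
  rw [h]
  refine Finset.sum_congr rfl fun t _ => ?_
  rw [Polynomial.eval_mul, Polynomial.eval_C, ← hP, id, mul_comm]

/-- The determinant is `1` at `s = 0` and cannot vanish along `1 + s • A`, which stays invertible by
the Neumann series. -/
theorem det_one_add_pos {A : E →L[ℝ] E} (hA : ‖A‖ < 1) : 0 < (1 + A).det := by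
  have hne : ∀ s ∈ Set.Icc (0 : ℝ) 1, (1 + s • A).det ≠ 0 := by
    intro s hs
    have hn : ‖-(s • A)‖ < 1 := by
      rw [norm_neg, norm_smul, Real.norm_of_nonneg hs.1]
      nlinarith [norm_nonneg A, hs.2]
    have := isUnit_one_sub_of_norm_lt_one hn
    rw [sub_neg_eq_add] at this
    have h1 : IsUnit (ContinuousLinearMap.toLinearMapRingHom (1 + s • A)) := this.map _
    exact (h1.map LinearMap.det).ne_zero
  have hc : ContinuousOn (fun s : ℝ => (1 + s • A).det) (Set.Icc 0 1) :=
    (ContinuousLinearMap.continuous_det.comp (by fun_prop)).continuousOn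
  by_contra hneg
  have h0 : (1 + (0 : ℝ) • A).det = 1 := by
    rw [zero_smul, add_zero]; exact LinearMap.det_id
  have := intermediate_value_Icc' zero_le_one hc
  have hm : (0 : ℝ) ∈ Set.Icc ((1 + (1 : ℝ) • A).det) ((1 + (0 : ℝ) • A).det) := by
    rw [h0, one_smul]; exact ⟨not_lt.1 hneg, zero_le_one⟩
  obtain ⟨s, hs, hs0⟩ := this hm
  exact hne s hs hs0

/-- For small `t`, `x + t g x` is a bijection fixing the complement of `U`, so it maps `U` onto
itself and the Jacobian integrates to the volume. Interpolation in `t` carries this to `t = 1`,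
where injectivity may fail. -/
theorem integral_det_one_add_fderiv [MeasurableSpace E] [BorelSpace E]
    (ν : Measure E) [ν.IsAddHaarMeasure] {g : E → E} {K : NNReal} {U : Set E}
    (hg : LipschitzWith K g) (hU : IsOpen U) (hν : ν U ≠ ⊤)
    (h0 : ∀ x ∉ U, g x = 0) (hd : ∀ x ∈ U, DifferentiableAt ℝ g x) :
    ∫ x in U, (1 + fderiv ℝ g x).det ∂ν = ν.real U := by
  have hε : (0 : ℝ) < 1 / (K + 1) := by positivity
  obtain ⟨s, c, hs, hc⟩ := exists_det_one_add_eq_sum (E := E) hε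
  have hnorm : ∀ x, ∀ t ∈ s, ‖t • fderiv ℝ g x‖ < 1 := by
    intro x t ht
    obtain ⟨ht0, ht1⟩ := hs t ht
    rw [norm_smul, Real.norm_of_nonneg ht0.le]
    have h1 := norm_fderiv_le_of_lipschitz ℝ hg (x₀ := x)
    rw [lt_div_iff₀ (by positivity)] at ht1
    nlinarith [norm_nonneg (fderiv ℝ g x), K.coe_nonneg]
  have key : ∀ t ∈ s, IntegrableOn (fun x => (1 + t • fderiv ℝ g x).det) U ν ∧
      ∫ x in U, (1 + t • fderiv ℝ g x).det ∂ν = ν.real U := by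
    intro t ht
    obtain ⟨ht0, ht1⟩ := hs t ht
    have hlip : LipschitzWith (t.toNNReal * K) (fun x => t • g x) := by
      have := (lipschitzWith_smul (β := E) t).comp hg
      have h : ‖t‖₊ = t.toNNReal := by
        ext; simp [ht0.le, abs_of_pos ht0]
      rwa [h] at this
    have hlt : t.toNNReal * K < 1 := by
      rw [← NNReal.coe_lt_coe, NNReal.coe_mul, Real.coe_toNNReal _ ht0.le]
      rw [lt_div_iff₀ (by positivity)] at ht1
      push_cast
      nlinarith
    have hbij := bijective_add_of_lipschitzWith hlt hlip
    have himg : (fun x => x + t • g x) '' U = U := by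
      have hout : ∀ x ∉ U, x + t • g x = x := fun x hx => by simp [h0 x hx]
      apply Set.Subset.antisymm
      · rintro _ ⟨x, hx, rfl⟩
        by_contra hy
        have := hbij.1 (hout _ hy)
        simp only at this hy
        rw [this] at hy
        exact hy hx
      · intro y hy
        obtain ⟨x, hx⟩ := hbij.2 y
        refine ⟨x, ?_, hx⟩
        by_contra hxU
        have := hout x hxU
        simp only at hx
        rw [this] at hx
        exact hxU (hx ▸ hy)
    have hder : ∀ x ∈ U, HasFDerivWithinAt (fun x => x + t • g x) (1 + t • fderiv ℝ g x) U x :=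
      fun x hx => ((hasFDerivAt_id x).add ((hd x hx).hasFDerivAt.const_smul t)).hasFDerivWithinAt
    have habs : ∀ x, |(1 + t • fderiv ℝ g x).det| = (1 + t • fderiv ℝ g x).det :=
      fun x => abs_of_pos (det_one_add_pos (hnorm x t ht))
    have hI := integrableOn_image_iff_integrableOn_abs_det_fderiv_smul ν hU.measurableSet hder
      hbij.1.injOn (fun _ => (1 : ℝ))
    have hJ := integral_image_eq_integral_abs_det_fderiv_smul ν hU.measurableSet hder
      hbij.1.injOn (fun _ => (1 : ℝ))
    simp only [habs, himg, smul_eq_mul, mul_one] at hI hJ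
    refine ⟨hI.1 (integrableOn_const hν), ?_⟩
    rw [← hJ]
    simp
  have hsum : ∑ t ∈ s, c t = 1 := by
    have := hc 0
    have h1 : (1 : E →L[ℝ] E).det = 1 := LinearMap.det_id
    simpa [h1] using this.symm
  calc ∫ x in U, (1 + fderiv ℝ g x).det ∂ν
      = ∫ x in U, ∑ t ∈ s, c t * (1 + t • fderiv ℝ g x).det ∂ν := by simp_rw [← hc]
    _ = ∑ t ∈ s, ∫ x in U, c t * (1 + t • fderiv ℝ g x).det ∂ν :=
        integral_finsetSum _ fun t ht => (key t ht).1.const_mul _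
    _ = ∑ t ∈ s, c t * ν.real U :=
        Finset.sum_congr rfl fun t ht => by rw [integral_const_mul, (key t ht).2]
    _ = ν.real U := by rw [← Finset.sum_mul, hsum, one_mul]
end

section
variable {E : Type*} [NormedAddCommGroup E] [InnerProductSpace ℝ E]

theorem lipschitzWith_indicator_ball {F : Type*} [NormedAddCommGroup F] {g : E → F} {ρ : ℝ}
    {K : NNReal}
    (hg : LipschitzOnWith K g (Metric.closedBall 0 ρ)) (h0 : ∀ x, ‖x‖ = ρ → g x = 0) :
    LipschitzWith K ((Metric.ball 0 ρ).indicator g) := by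
  have key : ∀ x y : E, ‖x‖ < ρ → ρ ≤ ‖y‖ → ‖g x‖ ≤ K * dist x y := by
    intro x y hx hy
    -- The segment from `x` to `y` meets the sphere, where `g` vanishes.
    have hc : ContinuousOn (fun s : ℝ => ‖x + s • (y - x)‖) (Set.Icc 0 1) := by fun_prop
    have hm : ρ ∈ Set.Icc ‖x + (0 : ℝ) • (y - x)‖ ‖x + (1 : ℝ) • (y - x)‖ := by
      simpa using ⟨hx.le, hy⟩
    obtain ⟨s, hs, hsρ⟩ := intermediate_value_Icc zero_le_one hc hm
    simp only at hsρ
    have h1 := hg.dist_le_mul x (by simpa using hx.le) (x + s • (y - x)) (by simpa using hsρ.le)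
    rw [h0 _ hsρ, dist_zero_right] at h1
    refine h1.trans (mul_le_mul_of_nonneg_left ?_ K.coe_nonneg)
    rw [dist_eq_norm, dist_eq_norm, sub_add_cancel_left, norm_neg, norm_smul,
      Real.norm_of_nonneg hs.1, norm_sub_rev]
    exact mul_le_of_le_one_left (norm_nonneg _) hs.2
  refine LipschitzWith.of_dist_le_mul fun x y => ?_
  by_cases hx : ‖x‖ < ρ <;> by_cases hy : ‖y‖ < ρ
  · rw [Set.indicator_of_mem (by simpa using hx), Set.indicator_of_mem (by simpa using hy)]
    exact hg.dist_le_mul x (by simpa using hx.le) y (by simpa using hy.le)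
  · rw [Set.indicator_of_mem (by simpa using hx), Set.indicator_of_notMem (by simpa using hy),
      dist_zero_right]
    exact key x y hx (not_lt.1 hy)
  · rw [Set.indicator_of_notMem (by simpa using hx), Set.indicator_of_mem (by simpa using hy),
      dist_zero_left, dist_comm]
    exact key y x hy (not_lt.1 hx)
  · rw [Set.indicator_of_notMem (by simpa using hx), Set.indicator_of_notMem (by simpa using hy),
      dist_self]
    positivity

variable [FiniteDimensional ℝ E]

/-- There is no `C¹` retraction of a closed ball onto its boundary sphere. -/
theorem not_contDiff_retraction {r : E → E} {ρ : ℝ} (hρ : 0 < ρ) (hr : ContDiff ℝ 1 r)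
    (hnorm : ∀ x, ‖r x‖ = ρ) (hid : ∀ x, ‖x‖ = ρ → r x = x) : False := by
  borelize E
  set g : E → E := (Metric.ball 0 ρ).indicator (fun x => r x - x)
  have hdiff : ContDiff ℝ 1 (fun x => r x - x) := hr.sub contDiff_id
  obtain ⟨K, hK⟩ := hdiff.locallyLipschitz.locallyLipschitzOn.exists_lipschitzOnWith_of_compact
    (isCompact_closedBall (0 : E) ρ)
  have hg : LipschitzWith K g :=
    lipschitzWith_indicator_ball hK fun x hx => by rw [hid x hx, sub_self]
  have heq : ∀ x ∈ Metric.ball (0 : E) ρ, g =ᶠ[nhds x] fun x => r x - x := fun x hx =>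
    Filter.eventuallyEq_of_mem (Metric.isOpen_ball.mem_nhds hx) fun y hy =>
      Set.indicator_of_mem hy _
  have hrd : ∀ x, HasFDerivAt r (fderiv ℝ r x) x := fun x =>
    (hr.differentiable one_ne_zero x).hasFDerivAt
  have hgd : ∀ x ∈ Metric.ball (0 : E) ρ,
      HasFDerivAt g (fderiv ℝ r x - ContinuousLinearMap.id ℝ E) x := fun x hx =>
    ((hrd x).sub (hasFDerivAt_id x)).congr_of_eventuallyEq (heq x hx)
  have hI := integral_det_one_add_fderiv (Measure.addHaar : Measure E) hg Metric.isOpen_ball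
    measure_ball_lt_top.ne (fun x hx => Set.indicator_of_notMem hx _)
    (fun x hx => (hgd x hx).differentiableAt)
  have hzero : ∀ x ∈ Metric.ball (0 : E) ρ, (1 + fderiv ℝ g x).det = 0 := by
    intro x hx
    rw [(hgd x hx).fderiv]
    have : (1 : E →L[ℝ] E) + (fderiv ℝ r x - ContinuousLinearMap.id ℝ E) = fderiv ℝ r x :=
      add_sub_cancel _ _
    rw [this]
    by_contra hdet
    -- Since `‖r‖` is constant, the range of the derivative is orthogonal to `r x ≠ 0`, so it is not
    -- surjective.
    have hin : ∀ v, inner ℝ (r x) (fderiv ℝ r x v) = 0 := by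
      intro v
      have h1 := (hrd x).norm_sq
      have h2 : (fun y => ‖r y‖ ^ 2) = fun _ => ρ ^ 2 := by
        funext y; rw [hnorm]
      rw [h2] at h1
      have h3 := congrArg (fun L => L v) (h1.unique (hasFDerivAt_const _ _))
      simpa using h3
    obtain ⟨v, hv⟩ := ((LinearMap.isUnit_iff_isUnit_det _).2 (isUnit_iff_ne_zero.2 hdet) |>
      (Module.End.isUnit_iff _).1).2 (r x)
    have h4 := hin v
    change fderiv ℝ r x v = r x at hv
    rw [hv, real_inner_self_eq_norm_sq, hnorm] at h4
    exact absurd h4 (by positivity)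
  rw [setIntegral_congr_fun measurableSet_ball hzero] at hI
  simp only [integral_zero] at hI
  exact (ENNReal.toReal_pos (Metric.measure_ball_pos (Measure.addHaar : Measure E) 0 hρ).ne'
    measure_ball_lt_top.ne).ne hI

/-- A `C¹` vector field which points outwards far from the origin has a zero. -/
theorem exists_eq_zero_of_inner_pos {F : E → E} {R : ℝ} (hR : 0 < R) (hF : ContDiff ℝ 1 F)
    (h : ∀ x, R ≤ ‖x‖ → 0 < inner ℝ (F x) x) : ∃ x, F x = 0 := by
  by_contra! hne
  let φ : ContDiffBump (0 : E) := ⟨R, 2 * R, hR, by linarith⟩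
  -- `G` agrees with `F` near the origin and with the identity on the sphere of radius `2 * R`, and
  -- never vanishes; normalising it gives a retraction.
  let G : E → E := fun x => φ x • F x + (1 - φ x) • x
  have hG : ContDiff ℝ 1 G :=
    (φ.contDiff.smul hF).add ((contDiff_const.sub φ.contDiff).smul contDiff_id)
  have hG0 : ∀ x, G x ≠ 0 := by
    intro x hx
    rcases le_total R ‖x‖ with hxR | hxR
    · have h1 : inner ℝ (G x) x = φ x * inner ℝ (F x) x + (1 - φ x) * ‖x‖ ^ 2 := by
        simp [G, inner_add_left, inner_smul_left]
      rw [hx, inner_zero_left] at h1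
      have h2 := h x hxR
      have h3 : 0 < ‖x‖ ^ 2 := by have := hR.trans_le hxR; positivity
      have h4 := φ.nonneg (x := x)
      have h5 := φ.le_one (x := x)
      rcases h4.eq_or_lt with h6 | h6
      · rw [← h6] at h1; linarith
      · nlinarith [mul_pos h6 h2, mul_nonneg (sub_nonneg.2 h5) h3.le]
    · have h1 : φ x = 1 := φ.one_of_mem_closedBall (by simpa using hxR)
      simp only [G, h1, one_smul, sub_self, zero_smul, add_zero] at hx
      exact hne x hx
  have hout : ∀ x, ‖x‖ = 2 * R → G x = x := by
    intro x hx
    have h1 : φ x = 0 := φ.zero_of_le_dist (by simpa using hx.ge)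
    simp [G, h1]
  have h2R : 0 < 2 * R := by positivity
  refine not_contDiff_retraction (r := fun x => ((2 * R) / ‖G x‖) • G x) h2R ?_ ?_ ?_
  · exact (contDiff_const.div (hG.norm ℝ hG0) fun x => norm_ne_zero_iff.2 (hG0 x)).smul hG
  · intro x
    have := norm_pos_iff.2 (hG0 x)
    rw [norm_smul, norm_div, norm_norm, div_mul_cancel₀ _ this.ne', Real.norm_of_nonneg h2R.le]
  · intro x hx
    rw [hout x hx, hx, div_self h2R.ne', one_smul]
end

/-! ### Common transversals of closed covers -/

theorem abs_le_of_sum_eq {n : ℕ} {w : Fin n → ℝ} {D m : ℝ} (hn : 0 < n) (hD : 0 ≤ D)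
    (hm : ∑ k, w k = n * m) (h1 : ∀ k, w k ≤ m + D) (h2 : n * m ^ 2 ≤ D) (j : Fin n) :
    |w j| ≤ n * D + 2 * D + 1 := by
  have hn1 : (1 : ℝ) ≤ n := by exact_mod_cast hn
  have h3 : m + D - w j ≤ ∑ k, (m + D - w k) :=
    Finset.single_le_sum (f := fun k => m + D - w k) (fun k _ => sub_nonneg.2 (h1 k))
      (Finset.mem_univ j)
  rw [Finset.sum_sub_distrib, hm] at h3
  simp only [Finset.sum_const, Finset.card_univ, Fintype.card_fin, nsmul_eq_mul] at h3
  have hm2 : |m| ≤ D + 1 := by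
    refine abs_le_of_sq_le_sq ?_ (by linarith)
    nlinarith [sq_nonneg m]
  obtain ⟨hma, hmb⟩ := abs_le.1 hm2
  have := h1 j
  have hnD : 0 ≤ n * D := by positivity
  exact abs_le.2 ⟨by linarith, by linarith⟩

theorem euclideanSpace_norm_le {n : ℕ} {w : EuclideanSpace ℝ (Fin n)} {B : ℝ} (hB : 0 ≤ B)
    (h : ∀ j, |w j| ≤ B) : ‖w‖ ≤ n * B := by
  refine abs_le_of_sq_le_sq' ?_ (by positivity) |>.2
  rw [EuclideanSpace.real_norm_sq_eq]
  have h1 : ∑ j, w j ^ 2 ≤ ∑ _j : Fin n, B ^ 2 :=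
    Finset.sum_le_sum fun j _ => sq_le_sq' (abs_le.1 (h j)).1 (abs_le.1 (h j)).2
  have h2 : (n : ℝ) ≤ n ^ 2 := by exact_mod_cast Nat.le_self_pow two_ne_zero n
  simp only [Finset.sum_const, Finset.card_univ, Fintype.card_fin, nsmul_eq_mul] at h1
  nlinarith [sq_nonneg B]

/-- A probability-valued smooth field that puts mass only on coordinates which are nearly maximal
attains the uniform distribution. -/
theorem exists_forall_eq_inv {n : ℕ} (hn : 0 < n) {D : ℝ} (hD : 0 ≤ D)
    {q : EuclideanSpace ℝ (Fin n) → Fin n → ℝ} (hq : ∀ j, ContDiff ℝ 1 fun w => q w j)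
    (hq0 : ∀ w j, 0 ≤ q w j) (hq1 : ∀ w, ∑ j, q w j = 1)
    (hqD : ∀ w j k, q w j ≠ 0 → w k - D ≤ w j) :
    ∃ w, ‖w‖ ≤ n * (n * D + 2 * D + 1) + 1 ∧ ∀ j, q w j = (n : ℝ)⁻¹ := by
  have hn0 : (0 : ℝ) < n := by exact_mod_cast hn
  have : Nonempty (Fin n) := ⟨⟨0, hn⟩⟩
  let m : EuclideanSpace ℝ (Fin n) → ℝ := fun w => (∑ k, w k) / n
  have hm : ∀ w, ∑ k, w k = n * m w := fun w => by
    simp only [m]; field_simp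
  -- `q - 1/n` has coordinate sum zero. Adding the mean `m w` makes the field outward along the
  -- diagonal too, and at a zero summing coordinates forces `m w = 0`.
  let F : EuclideanSpace ℝ (Fin n) → EuclideanSpace ℝ (Fin n) :=
    fun w => WithLp.toLp 2 fun j => q w j - (n : ℝ)⁻¹ + m w
  have hcoord : ∀ k : Fin n, ContDiff ℝ 1 fun w : EuclideanSpace ℝ (Fin n) => w k :=
    fun k => contDiff_piLp_apply (p := 2) (E := fun _ : Fin n => ℝ)
  have hF : ContDiff ℝ 1 F := by
    refine contDiff_euclidean.2 fun j => ?_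
    exact ((hq j).sub contDiff_const).add ((ContDiff.sum fun k _ => hcoord k).div_const _)
  have hin : ∀ w, inner ℝ (F w) w = ∑ j, q w j * w j - m w + n * m w ^ 2 := by
    intro w
    rw [PiLp.inner_apply]
    have : ∀ j, inner ℝ ((F w) j) (w j) = q w j * w j - (n : ℝ)⁻¹ * w j + m w * w j := by
      intro j
      simp only [F, RCLike.inner_apply, conj_trivial]
      ring
    rw [Finset.sum_congr rfl fun j _ => this j, Finset.sum_add_distrib, Finset.sum_sub_distrib,
      ← Finset.mul_sum, ← Finset.mul_sum, hm]
    field_simp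
  set B := n * D + 2 * D + 1
  have hB0 : 0 ≤ B := by positivity
  have hpos : ∀ w, n * B + 1 ≤ ‖w‖ → 0 < inner ℝ (F w) w := by
    intro w hw
    by_contra hle
    rw [hin, not_lt] at hle
    obtain ⟨k₀, hk₀⟩ := Finite.exists_max fun k => w k
    have h1 : w k₀ - D ≤ ∑ j, q w j * w j := by
      have h2 : ∑ j, q w j * (w k₀ - D) ≤ ∑ j, q w j * w j := by
        refine Finset.sum_le_sum fun j _ => ?_
        by_cases hj : q w j = 0
        · simp [hj]
        · exact mul_le_mul_of_nonneg_left (hqD w j k₀ hj) (hq0 w j)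
      rwa [← Finset.sum_mul, hq1, one_mul] at h2
    have h3 : m w ≤ w k₀ := by
      have : ∑ k, w k ≤ ∑ _k : Fin n, w k₀ := Finset.sum_le_sum fun k _ => hk₀ k
      rw [hm] at this
      simp only [Finset.sum_const, Finset.card_univ, Fintype.card_fin, nsmul_eq_mul] at this
      exact le_of_mul_le_mul_left this hn0
    have h4 : 0 ≤ n * m w ^ 2 := by positivity
    -- A nonpositive inner product gives `n * m² ≤ m - max + D`; with `m ≤ max` this bounds both
    -- `max - m` and `n * m²` by `D`.
    have := euclideanSpace_norm_le hB0 fun j =>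
      abs_le_of_sum_eq hn hD (hm w) (fun k => (hk₀ k).trans (by linarith)) (by linarith) j
    linarith
  obtain ⟨w, hw⟩ := exists_eq_zero_of_inner_pos (by positivity) hF hpos
  have hnorm : ‖w‖ ≤ n * B + 1 := by
    by_contra hlt
    have := hpos w (not_le.1 hlt).le
    rw [hw, inner_zero_left] at this
    exact this.false
  have hwj : ∀ j, q w j - (n : ℝ)⁻¹ + m w = 0 := fun j =>
    congrArg (fun v : EuclideanSpace ℝ (Fin n) => v j) hw
  have hm0 : m w = 0 := by
    have h1 : ∑ j, (q w j - (n : ℝ)⁻¹ + m w) = 0 := Finset.sum_eq_zero fun j _ => hwj j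
    rw [Finset.sum_add_distrib, Finset.sum_sub_distrib, hq1] at h1
    simp only [Finset.sum_const, Finset.card_univ, Fintype.card_fin, nsmul_eq_mul] at h1
    rw [mul_inv_cancel₀ hn0.ne', sub_self, zero_add] at h1
    exact (mul_eq_zero.1 h1).resolve_left hn0.ne'
  refine ⟨w, hnorm, fun j => ?_⟩
  have := hwj j
  rw [hm0] at this
  linarith

/-- Any permutation with nonzero coefficient in a Birkhoff decomposition works. -/
theorem exists_perm_pos_of_doublyStochastic {ι : Type*} [Fintype ι] [DecidableEq ι]
    {M : Matrix ι ι ℝ} (hM : M ∈ doublyStochastic ℝ ι) :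
    ∃ π : Equiv.Perm ι, ∀ i, 0 < M i (π i) := by
  obtain ⟨c, hc0, hc1, hcM⟩ := exists_eq_sum_perm_of_mem_doublyStochastic hM
  obtain ⟨σ, -, hσ⟩ := Finset.exists_ne_zero_of_sum_ne_zero (hc1.trans_ne one_ne_zero)
  refine ⟨σ, fun i => ?_⟩
  rw [← hcM, Matrix.sum_apply]
  have hnn : ∀ τ : Equiv.Perm ι, 0 ≤ (c τ • τ.permMatrix ℝ) i (σ i) := fun τ =>
    mul_nonneg (hc0 τ) (nonneg_of_mem_doublyStochastic permMatrix_mem_doublyStochastic)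
  refine Finset.sum_pos' (fun τ _ => hnn τ) ⟨σ, Finset.mem_univ _, ?_⟩
  have : (c σ • σ.permMatrix ℝ) i (σ i) = c σ := by
    simp [Equiv.Perm.permMatrix, PEquiv.toMatrix_apply, Equiv.toPEquiv_apply]
  rw [this]
  exact (hc0 σ).lt_of_ne' hσ

/-- Mollification of a measurable partition of unity. -/
theorem exists_contDiff_partition {E ι : Type*} [NormedAddCommGroup E] [InnerProductSpace ℝ E]
    [FiniteDimensional ℝ E] [Fintype ι] {δ : ℝ} (hδ : 0 < δ) {A : ι → Set E}
    (hA : ∀ j, IsClosed (A j)) (hcov : ∀ w, ∃ j, w ∈ A j) :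
    ∃ p : E → ι → ℝ, (∀ j, ContDiff ℝ 1 fun w => p w j) ∧ (∀ w j, 0 ≤ p w j) ∧
      (∀ w, ∑ j, p w j = 1) ∧ ∀ w j, p w j ≠ 0 → ∃ w' ∈ A j, dist w' w < δ := by
  borelize E
  let I : ι → E → ℝ := fun j => (A j).indicator 1
  have hI0 : ∀ j w, 0 ≤ I j w := fun j w => Set.indicator_nonneg (fun _ _ => zero_le_one) w
  let S : E → ℝ := fun w => ∑ j, I j w
  have hS : ∀ w, 0 < S w := fun w => by
    obtain ⟨j, hj⟩ := hcov w
    refine Finset.sum_pos' (fun j _ => hI0 j w) ⟨j, Finset.mem_univ _, ?_⟩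
    simp [I, hj]
  -- The sets may overlap, so indicators are divided by the number of sets containing the point.
  let g : ι → E → ℝ := fun j w => I j w / S w
  have hg0 : ∀ j w, 0 ≤ g j w := fun j w => div_nonneg (hI0 j w) (hS w).le
  have hg1 : ∀ j w, g j w ≤ 1 := fun j w => (div_le_one (hS w)).2
    (Finset.single_le_sum (f := fun j => I j w) (fun j _ => hI0 j w) (Finset.mem_univ j))
  have hgs : ∀ w, ∑ j, g j w = 1 := fun w => by
    simp only [g]; rw [← Finset.sum_div]; exact div_self (hS w).ne'
  have hIm : ∀ j, Measurable (I j) := fun j => measurable_one.indicator (hA j).measurableSet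
  have hgm : ∀ j, Measurable (g j) := fun j =>
    (hIm j).div (Finset.measurable_sum _ fun k _ => hIm k)
  let φ : ContDiffBump (0 : E) := ⟨δ / 2, δ, by positivity, by linarith⟩
  have hloc : ∀ j, LocallyIntegrable (g j) (volume : Measure E) := fun j =>
    (locallyIntegrable_const (1 : ℝ)).mono (hgm j).aestronglyMeasurable
      (Filter.Eventually.of_forall fun w => by
        rw [Real.norm_of_nonneg (hg0 j w)]; simpa using hg1 j w)
  have hint : ∀ j w, Integrable (fun u => φ.normed volume u * g j (w - u)) volume := fun j w =>
    φ.integrable_normed.mul_bdd (c := 1)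
      ((hgm j).comp (measurable_const.sub measurable_id)).aestronglyMeasurable
      (Filter.Eventually.of_forall fun u => by
        rw [Real.norm_of_nonneg (hg0 j _)]; exact hg1 j _)
  refine ⟨fun w j => ∫ u, φ.normed volume u * g j (w - u), fun j => ?_, fun w j => ?_,
    fun w => ?_, fun w j hne => ?_⟩
  · have := (φ.hasCompactSupport_normed (μ := (volume : Measure E))).contDiff_convolution_left
      (μ := (volume : Measure E)) (ContinuousLinearMap.lsmul ℝ ℝ) (n := 1) φ.contDiff_normed (hloc j)
    exact this
  · exact integral_nonneg fun u => mul_nonneg (φ.nonneg_normed u) (hg0 j _)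
  · rw [← integral_finsetSum _ fun j _ => hint j w]
    simp_rw [← Finset.mul_sum, hgs, mul_one]
    exact φ.integral_normed (μ := (volume : Measure E))
  · by_contra! hno
    refine hne (integral_eq_zero_of_ae (Filter.Eventually.of_forall fun u => ?_))
    by_cases hu : ‖u‖ < δ
    · have hnot : w - u ∉ A j := fun hmem => by
        have := hno _ hmem
        rw [dist_eq_norm, sub_sub_cancel_left, norm_neg] at this
        exact hu.not_ge this
      simp [g, I, hnot]
    · have : φ u = 0 := φ.zero_of_le_dist (by simpa using hu)
      simp [ContDiffBump.normed_def, this]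

theorem exists_perm_approx {n : ℕ} (hn : 0 < n) {D : ℝ} (hD : 0 ≤ D)
    {A : Fin n → Fin n → Set (EuclideanSpace ℝ (Fin n))} (hA : ∀ i j, IsClosed (A i j))
    (hcov : ∀ i w, ∃ j, w ∈ A i j) (hAD : ∀ i j w k, w ∈ A i j → w k - D ≤ w j)
    {δ : ℝ} (hδ : 0 < δ) (hδ1 : δ ≤ 1) :
    ∃ w : EuclideanSpace ℝ (Fin n), ‖w‖ ≤ n * (n * (D + 2) + 2 * (D + 2) + 1) + 1 ∧
      ∃ π : Equiv.Perm (Fin n), ∀ i, ∃ w' ∈ A i (π i), dist w' w < δ := by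
  have hn0 : (0 : ℝ) < n := by exact_mod_cast hn
  choose p hp hp0 hp1 hpA using fun i => exists_contDiff_partition hδ (hA i) (hcov i)
  -- Passing to a point within `δ ≤ 1` costs at most `1` in each of the two compared coordinates,
  -- hence `D + 2`.
  obtain ⟨w, hw, hwq⟩ := exists_forall_eq_inv hn (D := D + 2) (by positivity)
    (q := fun w j => (n : ℝ)⁻¹ * ∑ i, p i w j)
    (fun j => contDiff_const.mul (ContDiff.sum fun i _ => hp i j))
    (fun w j => mul_nonneg (by positivity) (Finset.sum_nonneg fun i _ => hp0 i w j))
    (fun w => by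
      rw [← Finset.mul_sum, Finset.sum_comm, Finset.sum_congr rfl fun i _ => hp1 i w]
      simp [hn0.ne'])
    (fun w j k hne => by
      obtain ⟨i, -, hi⟩ := Finset.exists_ne_zero_of_sum_ne_zero (right_ne_zero_of_mul hne)
      obtain ⟨w', hw', hd⟩ := hpA i w j hi
      have h1 := hAD i j w' k hw'
      have hc : ∀ l, |w' l - w l| ≤ 1 := fun l => by
        have := PiLp.norm_apply_le (w' - w) l
        rw [← dist_eq_norm] at this
        exact this.trans (hd.le.trans hδ1)
      have h2 := abs_le.1 (hc k)
      have h3 := abs_le.1 (hc j)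
      linarith [h2.1, h3.2])
  refine ⟨w, hw, ?_⟩
  have hM : (Matrix.of fun i j => p i w j) ∈ doublyStochastic ℝ (Fin n) := by
    rw [mem_doublyStochastic_iff_sum]
    refine ⟨fun i j => hp0 i w j, fun i => hp1 i w, fun j => ?_⟩
    exact mul_left_cancel₀ (inv_ne_zero hn0.ne') ((hwq j).trans (mul_one _).symm)
  obtain ⟨π, hπ⟩ := exists_perm_pos_of_doublyStochastic hM
  exact ⟨π, fun i => hpA i w (π i) (hπ i).ne'⟩

/-- A KKM–Gale type theorem: `n` closed covers of `ℝ^n` whose members only contain points at which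
the corresponding coordinate is nearly maximal admit a common transversal point. -/
theorem exists_perm_mem_of_closed_covers {n : ℕ} (hn : 0 < n) {D : ℝ} (hD : 0 ≤ D)
    {A : Fin n → Fin n → Set (EuclideanSpace ℝ (Fin n))} (hA : ∀ i j, IsClosed (A i j))
    (hcov : ∀ i w, ∃ j, w ∈ A i j) (hAD : ∀ i j w k, w ∈ A i j → w k - D ≤ w j) :
    ∃ w, ∃ π : Equiv.Perm (Fin n), ∀ i, w ∈ A i (π i) := by
  set R : ℝ := n * (n * (D + 2) + 2 * (D + 2) + 1) + 1
  have hδ : ∀ m : ℕ, (0 : ℝ) < 1 / (m + 1) := fun m => by positivity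
  choose w hw π hπ using fun m : ℕ => exists_perm_approx hn hD hA hcov hAD (hδ m)
    (by rw [div_le_one (by positivity)]; linarith [m.cast_nonneg (α := ℝ)])
  -- Finitely many permutations: one recurs infinitely often. The bound `R` does not depend on `δ`,
  -- so a subsequence converges.
  obtain ⟨σ, hσ⟩ := Finite.exists_infinite_fiber π
  have hinf : {m | π m = σ}.Infinite := Set.infinite_coe_iff.1 hσ
  let e := Nat.nth fun m => π m = σ
  have he : StrictMono e := Nat.nth_strictMono hinf
  have heσ : ∀ m, π (e m) = σ := Nat.nth_mem_of_infinite hinf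
  obtain ⟨w₀, -, f, hf, hlim⟩ := (isCompact_closedBall (0 : EuclideanSpace ℝ (Fin n)) R).tendsto_subseq
    (x := fun m => w (e m)) fun m => by simpa using hw (e m)
  refine ⟨w₀, σ, fun i => ?_⟩
  choose w' hw' hd using fun m => hπ (e (f m)) i
  refine (hA i (σ i)).mem_of_tendsto (f := w') (b := Filter.atTop) ?_
    (Filter.Eventually.of_forall fun m => by have := hw' m; rwa [heσ] at this)
  have hd0 : Filter.Tendsto (fun m => dist (w (e (f m))) (w' m)) Filter.atTop (nhds 0) := by
    refine squeeze_zero (fun m => dist_nonneg) (fun m => ?_)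
      ((tendsto_one_div_add_atTop_nhds_zero_nat (𝕜 := ℝ)).comp
        (he.comp hf).tendsto_atTop)
    rw [dist_comm]
    exact (hd m).le
  exact (tendsto_iff_of_dist hd0).1 hlim

/-! ### Power diagrams -/

section
variable {d n : ℕ}

theorem dist_sq_sub_dist_sq {E : Type*} [NormedAddCommGroup E] [InnerProductSpace ℝ E]
    (y a b : E) :
    dist y a ^ 2 - dist y b ^ 2 = 2 * inner ℝ (b - a) y + (‖a‖ ^ 2 - ‖b‖ ^ 2) := by
  rw [dist_eq_norm, dist_eq_norm, norm_sub_sq_real, norm_sub_sq_real, inner_sub_left,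
    real_inner_comm a, real_inner_comm b]
  ring

theorem mem_powerDiagram_iff_inner {x : Fin n → EuclideanSpace ℝ (Fin d)} {w : Fin n → ℝ}
    {j : Fin n} {y : EuclideanSpace ℝ (Fin d)} :
    y ∈ powerDiagram x w j ↔
      ∀ i, inner ℝ (x i - x j) y ≤ (w j - w i - (‖x j‖ ^ 2 - ‖x i‖ ^ 2)) / 2 := by
  refine forall_congr' fun i => ?_
  have := dist_sq_sub_dist_sq y (x j) (x i)
  constructor <;> intro h <;> linarith

theorem powerDiagram_eq_iInter (x : Fin n → EuclideanSpace ℝ (Fin d)) (w : Fin n → ℝ)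
    (j : Fin n) :
    powerDiagram x w j = ⋂ i, {y | inner ℝ (x i - x j) y ≤
      (w j - w i - (‖x j‖ ^ 2 - ‖x i‖ ^ 2)) / 2} := by
  ext y
  rw [mem_powerDiagram_iff_inner, Set.mem_iInter]
  rfl

theorem isClosed_powerDiagram (x : Fin n → EuclideanSpace ℝ (Fin d)) (w : Fin n → ℝ)
    (j : Fin n) : IsClosed (powerDiagram x w j) := by
  rw [powerDiagram_eq_iInter]
  exact isClosed_iInter fun i => isClosed_le (by fun_prop) continuous_const

theorem convex_powerDiagram (x : Fin n → EuclideanSpace ℝ (Fin d)) (w : Fin n → ℝ)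
    (j : Fin n) : Convex ℝ (powerDiagram x w j) := by
  rw [powerDiagram_eq_iInter]
  exact convex_iInter fun i => convex_halfSpace_le (innerSL ℝ (x i - x j)).isLinear _

theorem iUnion_powerDiagram (hn : 0 < n) (x : Fin n → EuclideanSpace ℝ (Fin d))
    (w : Fin n → ℝ) : ⋃ j, powerDiagram x w j = Set.univ := by
  have : Nonempty (Fin n) := ⟨⟨0, hn⟩⟩
  refine Set.eq_univ_of_forall fun y => Set.mem_iUnion.2 ?_
  exact Finite.exists_min fun j => dist y (x j) ^ 2 - w j

theorem volume_inner_eq {v : EuclideanSpace ℝ (Fin d)} (hv : v ≠ 0) (c : ℝ) :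
    volume {y | inner ℝ v y = c} = 0 := by
  rcases Set.eq_empty_or_nonempty {y | inner ℝ v y = c} with h | ⟨y₀, hy₀⟩
  · rw [h, measure_empty]
  · have hker : LinearMap.ker (innerSL ℝ v).toLinearMap ≠ ⊤ := fun h => by
      have h1 : v ∈ LinearMap.ker (innerSL ℝ v).toLinearMap := h ▸ Submodule.mem_top
      exact hv ((inner_self_eq_zero (𝕜 := ℝ)).1 h1)
    have hz := Measure.addHaar_submodule (volume : Measure (EuclideanSpace ℝ (Fin d))) _ hker
    rw [← measure_preimage_add_right volume (-y₀)] at hz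
    refine measure_mono_null (fun y hy => ?_) hz
    have hy' : inner ℝ v y = c := hy
    have hy₀' : inner ℝ v y₀ = c := hy₀
    change inner ℝ v (y + -y₀) = 0
    rw [inner_add_right, inner_neg_right, hy', hy₀', add_neg_cancel]

theorem volume_dist_sq_sub_eq {a b : EuclideanSpace ℝ (Fin d)} (hab : a ≠ b) (s t : ℝ) :
    volume {y | dist y a ^ 2 - s = dist y b ^ 2 - t} = 0 := by
  refine measure_mono_null (fun y hy => ?_)
    (volume_inner_eq (sub_ne_zero.2 hab.symm) ((s - t - (‖a‖ ^ 2 - ‖b‖ ^ 2)) / 2))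
  have hy' : dist y a ^ 2 - s = dist y b ^ 2 - t := hy
  have := dist_sq_sub_dist_sq y a b
  change inner ℝ (b - a) y = _
  linarith

theorem isConvexPartition_powerDiagram (hn : 0 < n) {x : Fin n → EuclideanSpace ℝ (Fin d)}
    (hx : Function.Injective x) (w : Fin n → ℝ) : IsConvexPartition (powerDiagram x w) where
  isClosed := isClosed_powerDiagram x w
  convex := convex_powerDiagram x w
  iUnion_eq := iUnion_powerDiagram hn x w
  disjoint_interior i j hij := by
    rw [Set.disjoint_iff_inter_eq_empty,
      ← (isOpen_interior.inter isOpen_interior).measure_eq_zero_iff volume]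
    -- The open intersection lies in a null hyperplane, so it is empty.
    refine measure_mono_null (fun y hy => ?_) (volume_dist_sq_sub_eq (hx.ne hij) (w i) (w j))
    exact le_antisymm (interior_subset hy.1 j) (interior_subset hy.2 i)

/-- Almost every point has no tie with site `j` at `w₀`; the strict inequalities persist nearby, so
cell indicators converge almost everywhere. -/
theorem continuous_measure_powerDiagram {μ : Measure (EuclideanSpace ℝ (Fin d))}
    [IsFiniteMeasure μ] (hμ : μ ≪ volume) {x : Fin n → EuclideanSpace ℝ (Fin d)}
    (hx : Function.Injective x) (j : Fin n) :
    Continuous fun w : Fin n → ℝ => μ (powerDiagram x w j) := by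
  refine continuous_iff_continuousAt.2 fun w₀ => ?_
  refine tendsto_measure_of_ae_tendsto_indicator_of_isFiniteMeasure (nhds w₀)
    (isClosed_powerDiagram x w₀ j).measurableSet
    (fun w => (isClosed_powerDiagram x w j).measurableSet) ?_
  have hne : ∀ i, i ≠ j → ∀ᵐ y ∂μ, dist y (x j) ^ 2 - w₀ j ≠ dist y (x i) ^ 2 - w₀ i :=
    fun i hi => hμ.ae_le (measure_eq_zero_iff_ae_notMem.1
      (volume_dist_sq_sub_eq (hx.ne hi.symm) (w₀ j) (w₀ i)))
  have hall : ∀ᵐ y ∂μ, ∀ i, i ≠ j → dist y (x j) ^ 2 - w₀ j ≠ dist y (x i) ^ 2 - w₀ i :=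
    ae_all_iff.2 fun i => by
      by_cases hi : i = j
      · simp [hi]
      · filter_upwards [hne i hi] with y hy _ using hy
  filter_upwards [hall] with y hy
  have hev : ∀ i, ∀ᶠ w in nhds w₀, (dist y (x j) ^ 2 - w j ≤ dist y (x i) ^ 2 - w i ↔
      dist y (x j) ^ 2 - w₀ j ≤ dist y (x i) ^ 2 - w₀ i) := by
    intro i
    by_cases hi : i = j
    · simp [hi]
    have h1 : Continuous fun w : Fin n → ℝ => dist y (x j) ^ 2 - w j := by fun_prop
    have h2 : Continuous fun w : Fin n → ℝ => dist y (x i) ^ 2 - w i := by fun_prop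
    rcases (hy i hi).lt_or_gt with h | h
    · filter_upwards [h1.continuousAt.eventually_lt h2.continuousAt h] with w hw
      exact iff_of_true hw.le h.le
    · filter_upwards [h2.continuousAt.eventually_lt h1.continuousAt h] with w hw
      exact iff_of_false hw.not_ge h.not_ge
  filter_upwards [Filter.eventually_all.2 hev] with w hw
  exact forall_congr' hw

/-- The cell lies in a sublevel set of the difference of squared distances that depends only on `D`;
these sets shrink to the empty set. -/
theorem exists_measure_powerDiagram_lt {μ : Measure (EuclideanSpace ℝ (Fin d))}
    [IsFiniteMeasure μ] (x : Fin n → EuclideanSpace ℝ (Fin d)) {ε : ENNReal} (hε : 0 < ε)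
    (j k : Fin n) :
    ∃ D : ℕ, ∀ w : Fin n → ℝ, w j ≤ w k - D → μ (powerDiagram x w j) < ε := by
  let f : EuclideanSpace ℝ (Fin d) → ℝ := fun y => dist y (x j) ^ 2 - dist y (x k) ^ 2
  have hf : Continuous f := by fun_prop
  have hlim := tendsto_measure_of_tendsto_indicator_of_isFiniteMeasure (A := ∅) Filter.atTop μ
    (As := fun m : ℕ => {y | f y ≤ -m})
    (fun m => (isClosed_le hf continuous_const).measurableSet) (fun y => by
      obtain ⟨m, hm⟩ := exists_nat_gt (-f y)
      filter_upwards [Filter.eventually_ge_atTop m] with l hl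
      have : (m : ℝ) ≤ l := by exact_mod_cast hl
      refine iff_of_false (fun h => ?_) id
      have : f y ≤ -(l : ℝ) := h
      linarith)
  rw [measure_empty] at hlim
  obtain ⟨D, hD⟩ := (hlim.eventually (gt_mem_nhds hε)).exists
  refine ⟨D, fun w hw => lt_of_le_of_lt (measure_mono fun y hy => ?_) hD⟩
  have := hy k
  change dist y (x j) ^ 2 - dist y (x k) ^ 2 ≤ -(D : ℝ)
  linarith

theorem exists_inv_le_measure_of_iUnion_eq_univ {α : Type*} [MeasurableSpace α]
    (hn : 0 < n) (μ : Measure α) [IsProbabilityMeasure μ] {C : Fin n → Set α}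
    (hC : ⋃ j, C j = Set.univ) : ∃ j, (n : ENNReal)⁻¹ ≤ μ (C j) := by
  by_contra! h
  have : Nonempty (Fin n) := ⟨⟨0, hn⟩⟩
  have h1 : (1 : ENNReal) ≤ ∑ j, μ (C j) := by
    rw [← measure_univ (μ := μ), ← hC]
    exact measure_iUnion_fintype_le μ C
  have h2 : ∑ j, μ (C j) < ∑ _j : Fin n, (n : ENNReal)⁻¹ :=
    ENNReal.sum_lt_sum_of_nonempty Finset.univ_nonempty fun j _ => h j
  rw [Finset.sum_const, Finset.card_univ, Fintype.card_fin, nsmul_eq_mul,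
    ENNReal.mul_inv_cancel (by exact_mod_cast hn.ne') (ENNReal.natCast_ne_top n)] at h2
  exact (h1.trans_lt h2).false
end

theorem mainTheorem8 (n d : ℕ) (hn : 0 < n) (hd : 0 < d)
    (μ : Fin n → Measure (EuclideanSpace ℝ (Fin d)))
    (hprob : ∀ i, IsProbabilityMeasure (μ i))
    (hac : ∀ i, (μ i).AbsolutelyContinuous volume)
    (x : Fin n → EuclideanSpace ℝ (Fin d)) (hx : Function.Injective x) :
    ∃ w : Fin n → ℝ, IsEnvyFreePartition μ (powerDiagram x w) := by
  have : Nonempty (Fin n) := ⟨⟨0, hn⟩⟩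
  have hε : (0 : ENNReal) < (n : ENNReal)⁻¹ := ENNReal.inv_pos.2 (ENNReal.natCast_ne_top n)
  choose D hD using fun i j k => exists_measure_powerDiagram_lt (μ := μ i) x hε j k
  -- A sum serves as a common upper bound for all `D i j k`.
  let N : ℕ := ∑ i, ∑ j, ∑ k, D i j k
  have hDN : ∀ i j k, D i j k ≤ N := fun i j k =>
    ((Finset.single_le_sum (f := fun k => D i j k) (fun _ _ => Nat.zero_le _)
      (Finset.mem_univ k)).trans (Finset.single_le_sum (f := fun j => ∑ k, D i j k)
      (fun _ _ => Nat.zero_le _) (Finset.mem_univ j))).trans (Finset.single_le_sum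
      (f := fun i => ∑ j, ∑ k, D i j k) (fun _ _ => Nat.zero_le _) (Finset.mem_univ i))
  let A : Fin n → Fin n → Set (EuclideanSpace ℝ (Fin n)) := fun i j =>
    {w | ∀ k, μ i (powerDiagram x w k) ≤ μ i (powerDiagram x w j)}
  have hcont : ∀ i j, Continuous fun w : EuclideanSpace ℝ (Fin n) =>
      μ i (powerDiagram x w j) := fun i j =>
    (continuous_measure_powerDiagram (hac i) hx j).comp (PiLp.continuous_ofLp 2 _)
  obtain ⟨w, π, hπ⟩ := exists_perm_mem_of_closed_covers hn (D := N) (Nat.cast_nonneg N) (A := A)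
    (fun i j => by
      simp only [A, Set.ofPred_forall]
      exact isClosed_iInter fun k => isClosed_le (hcont i k) (hcont i j))
    (fun i w => Finite.exists_max fun j => μ i (powerDiagram x w j))
    (fun i j w k hw => by
      by_contra hlt
      obtain ⟨l, hl⟩ := exists_inv_le_measure_of_iUnion_eq_univ hn (μ i)
        (iUnion_powerDiagram hn x w)
      have h1 : (D i j k : ℝ) ≤ N := by exact_mod_cast hDN i j k
      exact (hl.trans (hw l)).not_gt (hD i j k w (by linarith)))
  exact ⟨w, isConvexPartition_powerDiagram hn hx w, π, fun i i' => hπ i (π i')⟩
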